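/- Fix $\alpha\in(0,1)$, $T>0$, $d\in\mathbb{N}$, and set $N=\lfloor 1/\alpha\rfloor$, $V=\mathbb{R}^d$. For $t\ge 0$ let $\mathscr{C}^\alpha([0,t];V)$ be the set of $\alpha$-Hölder rough paths, i.e. maps $\mathbf{X}=(1,X^1,\dots,X^N)$ from $\{0\le r\le s\le t\}$ to $\bigoplus_{m\le N}V^{\otimes m}$ satisfying Chen's relation and $|\langle\mathbf{X}_{r,s},e_I\rangle|\le C|s-r|^{|I|\alpha}$ for all words $I$ with $|I|\le N$. Let $\Lambda^\alpha=\bigsqcup_{t\in[0,T]}\mathscr{C}^\alpha([0,t];V)$, let $K:\Lambda^\alpha\times\Lambda^\alpha\to\mathcal{L}(V)$ be an operator-valued kernel (that is, $K(x,z)=K(z,x)^{T}$, and the matrix $(\langle K(z_i,z_j)y_i,y_j\rangle)_{i,j}$ is positive semidefinite for all finite families $z_i\in\Lambda^\alpha$, $y_i\in V$), and let $\mathcal{H}_K$ be its reproducing kernel Hilbert space of functions $\Lambda^\alpha\to V$, with $\langle f,K(z,\cdot)v\rangle_{\mathcal{H}_K}=\langle f(z),v\rangle_V$. For a Banach space $W$,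 a path $y:[0,T]\to W$ and $\mathbf{X}\in\mathscr{C}^\alpha([0,T];V)$, a *controlled lift of $y$ along $\mathbf{X}$* is a family of maps $\mathbf{y}[e_I]:[0,T]\to W$, $|I|\le N-1$, extended linearly to tensors (levels beyond $N-1$ being discarded), with $\mathbf{y}_t[e_\emptyset]=y_t$ and, for some $C$ and all $0\le s\le t\le T$ and $|I|\le N-1$, $$\|\mathbf{y}_t[e_I]-\mathbf{y}_s[\mathbf{X}_{s,t}\otimes e_I]\|\le C|t-s|^{(N-|I|)\alpha},\qquad \|\mathbf{y}_t[e_I]-\mathbf{y}_s[e_I]\|\le C|t-s|^{\alpha}.$$ If $W=\mathcal{L}(V;E)$, the rough integral of $y$ with the lift $\mathbf{y}$ is $$\int_0^T y_t\,[d\mathbf{X}_t]=\lim_{|\mathcal{P}|\to0}\sum_{[s,t]\in\mathcal{P}}\sum_{|I|\le N-1}\sum_{k=1}^d\mathbf{X}^{Ik}_{s,t}\,\mathbf{y}_s[e_I][e_k]\in E .$$ **Proposition.** Let $\mathbf{X},\mathbf{Y}\in\mathscr{C}^\alpha([0,T];V)$. Let $\boldsymbol{K}(X)$ be a controlled lift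 along $\mathbf{X}$ of $s\mapsto K(\mathbf{X}|_{[0,s]},\cdot)\in\mathcal{L}(V;\mathcal{H}_K)$ and $\boldsymbol{K}(Y)$ a controlled lift along $\mathbf{Y}$ of $t\mapsto K(\mathbf{Y}|_{[0,t]},\cdot)\in\mathcal{L}(V;\mathcal{H}_K)$. Then the rough integrals $\Phi_{\mathbf{X}}=\int_0^TK(\mathbf{X}|_{[0,s]},\cdot)\,d\mathbf{X}_s$ and $\Phi_{\mathbf{Y}}=\int_0^TK(\mathbf{Y}|_{[0,t]},\cdot)\,d\mathbf{Y}_t$ (with these lifts) exist in $\mathcal{H}_K$, and $\mathcal{K}_\Phi(\mathbf{X},\mathbf{Y}):=\langle\Phi_{\mathbf{X}},\Phi_{\mathbf{Y}}\rangle_{\mathcal{H}_K}$ satisfies $$\mathcal{K}_\Phi(\mathbf{X},\mathbf{Y})=\int_{s=0}^T\Big\langle\int_{t=0}^TK(\mathbf{Y}|_{[0,t]},\mathbf{X}|_{[0,s]})\,d\mathbf{Y}_t,\,d\mathbf{X}_s\Big\rangle_V=\int_{t=0}^T\Big\langle\int_{s=0}^TK(\mathbf{X}|_{[0,s]},\mathbf{Y}|_{[0,t]})\,d\mathbf{X}_s,\,d\mathbf{Y}_t\Big\rangle_V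 ,$$ where all integrals exist as rough integrals of the controlled lifts inherited from $\boldsymbol{K}(X)$ and $\boldsymbol{K}(Y)$. Namely, in the first double integral, for each fixed $s$ the inner integrand has the lift $z\mapsto(\boldsymbol{K}(Y)_t[e_J]z)(\mathbf{X}|_{[0,s]})$ along $\mathbf{Y}$. The outer integrand has the lift $G$ along $\mathbf{X}$ given, for $|I|\le N-1$ and $z\in V$, by the rough integrals $$G_s[e_I][z]=\int_0^T\big\langle f(\mathbf{Y}|_{[0,t]}),d\mathbf{Y}_t\big\rangle_V\quad\text{with } f=\boldsymbol{K}(X)_s[e_I]z\in\mathcal{H}_K,$$ in which $t\mapsto\langle f(\mathbf{Y}|_{[0,t]}),\cdot\rangle_V$ has the lift $\langle f,\boldsymbol{K}(Y)_t[e_J](\cdot)\rangle_{\mathcal{H}_K}$ along $\mathbf{Y}$. The second double integral is understood in the same way with the roles of $(\mathbf{X},\boldsymbol{K}(X))$ and $(\mathbf{Y},\boldsymbol{K}(Y))$ exchanged. -/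

import Mathlib

open scoped InnerProductSpace

noncomputable section

/-- The number of levels `⌊1/α⌋` carried by an `α`-Hölder rough path. -/
def roughLevel (α : ℝ) : ℕ := ⌊1 / α⌋₊

/-- `α`-Hölder rough paths over `ℝ^d` on the time interval `[0, T]`: maps from the simplex
`{(s, t) | 0 ≤ s ≤ t ≤ T}` to the truncated tensor algebra `⨁_{m ≤ ⌊1/α⌋} (ℝ^d)^{⊗m}`, with scalar
component `1`, that satisfy Chen's relation `X_{s,t} = X_{s,u} ⊗ X_{u,t}` and
`|⟨X_{s,t}, e_I⟩| ≤ C |t - s|^{|I| α}`.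
A truncated tensor is given by its coordinates `⟨X_{s,t}, e_I⟩` along words `I` in the letters
`0, …, d - 1`. So that a rough path is exactly a function on the simplex and on the words of length
at most `⌊1/α⌋`, coordinates are set to zero everywhere else. -/
@[ext]
structure RoughPath (α T : ℝ) (d : ℕ) where
  coord : ℝ → ℝ → List (Fin d) → ℝ
  coord_eq_zero : ∀ s t I, ¬ (0 ≤ s ∧ s ≤ t ∧ t ≤ T ∧ I.length ≤ roughLevel α) → coord s t I = 0
  coord_nil : ∀ s t, 0 ≤ s → s ≤ t → t ≤ T → coord s t [] = 1
  chen : ∀ s u t, 0 ≤ s → s ≤ u → u ≤ t → t ≤ T → ∀ I : List (Fin d), I.length ≤ roughLevel α →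
    coord s t I = ∑ i ∈ Finset.range (I.length + 1), coord s u (I.take i) * coord u t (I.drop i)
  holder : ∃ C : ℝ, ∀ s t, 0 ≤ s → s ≤ t → t ≤ T → ∀ I : List (Fin d), I.length ≤ roughLevel α →
    |coord s t I| ≤ C * (t - s) ^ ((I.length : ℝ) * α)

/-- Market histories: the (disjoint) union over `t ∈ [0, T]` of the rough paths on `[0, t]`. -/
abbrev History (α T : ℝ) (d : ℕ) := Σ t : Set.Icc (0 : ℝ) T, RoughPath α (t : ℝ) d

/-- The restriction `X|_{[0,t]}`, as a rough path on `[0, t]`. -/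
def RoughPath.restrict {α T : ℝ} {d : ℕ} (X : RoughPath α T d) (r : Set.Icc (0 : ℝ) T) :
    RoughPath α (r : ℝ) d where
  coord s t I := if t ≤ (r : ℝ) then X.coord s t I else 0
  coord_eq_zero s t I h := by
    split_ifs with ht
    · exact X.coord_eq_zero s t I fun h' => h ⟨h'.1, h'.2.1, ht, h'.2.2.2⟩
    · rfl
  coord_nil s t hs hst ht := by
    rw [if_pos ht]
    exact X.coord_nil s t hs hst (ht.trans r.2.2)
  chen s u t hs hsu hut ht I hI := by
    simp only [if_pos ht, if_pos (hut.trans ht)]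
    exact X.chen s u t hs hsu hut (ht.trans r.2.2) I hI
  holder := by
    obtain ⟨C, hC⟩ := X.holder
    refine ⟨C, fun s t hs hst ht I hI => ?_⟩
    rw [if_pos ht]
    exact hC s t hs hst (ht.trans r.2.2) I hI

/-- The restriction `X|_{[0,t]}`, as a market history. -/
def RoughPath.history {α T : ℝ} {d : ℕ} (X : RoughPath α T d) (t : Set.Icc (0 : ℝ) T) :
    History α T d := ⟨t, X.restrict t⟩

section Controlled

variable {α T : ℝ} {d : ℕ}

/-- `Y_s[X_{s,t} ⊗ e_I]`, where `Y_s` is a linear map on the tensors of levels `0, …, ⌊1/α⌋ - 1`,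
given by its values `Y s J = Y_s[e_J]` on words; levels of `X_{s,t} ⊗ e_I` beyond `⌊1/α⌋ - 1` are
discarded. -/
def RoughPath.transport {W : Type*} [NormedAddCommGroup W] [NormedSpace ℝ W]
    (X : RoughPath α T d) (Y : Set.Icc (0 : ℝ) T → List (Fin d) → W)
    (s t : Set.Icc (0 : ℝ) T) (I : List (Fin d)) : W :=
  ∑ k ∈ Finset.range (roughLevel α - I.length), ∑ J : Fin k → Fin d,
    X.coord s t (List.ofFn J) • Y s (List.ofFn J ++ I)

/-- `Y` is a path controlled by `X` that lifts the `W`-valued path `y`. Only the values of `Y` on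
words of length at most `⌊1/α⌋ - 1` matter. -/
structure RoughPath.IsControlledLift {W : Type*} [NormedAddCommGroup W] [NormedSpace ℝ W]
    (X : RoughPath α T d) (y : Set.Icc (0 : ℝ) T → W)
    (Y : Set.Icc (0 : ℝ) T → List (Fin d) → W) : Prop where
  lifts : ∀ t, Y t [] = y t
  remainder : ∃ C : ℝ, ∀ s t : Set.Icc (0 : ℝ) T, s ≤ t →
    ∀ I : List (Fin d), I.length < roughLevel α →
      ‖Y t I - X.transport Y s t I‖
        ≤ C * ((t : ℝ) - s) ^ (((roughLevel α : ℝ) - (I.length : ℝ)) * α)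
  holder : ∃ C : ℝ, ∀ s t : Set.Icc (0 : ℝ) T, s ≤ t →
    ∀ I : List (Fin d), I.length < roughLevel α → ‖Y t I - Y s I‖ ≤ C * ((t : ℝ) - s) ^ α

/-- The compensated increment `∑_{|I| ≤ ⌊1/α⌋ - 1} ∑_k X^{Ik}_{s,t} Y_s[e_I][e_k]`. -/
def RoughPath.germ {E : Type*} [NormedAddCommGroup E] [NormedSpace ℝ E]
    (X : RoughPath α T d)
    (Y : Set.Icc (0 : ℝ) T → List (Fin d) → (EuclideanSpace ℝ (Fin d) →L[ℝ] E))
    (s t : Set.Icc (0 : ℝ) T) : E :=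
  ∑ m ∈ Finset.range (roughLevel α), ∑ I : Fin m → Fin d, ∑ k : Fin d,
    X.coord s t (List.ofFn I ++ [k]) • Y s (List.ofFn I) (EuclideanSpace.single k 1)

/-- `L` is the rough integral `∫_0^T Y_s[dX_s]`: the limit, as the mesh of the partition
`0 = τ 0 ≤ τ 1 ≤ … ≤ τ n = T` tends to zero, of the sums of compensated increments. -/
def RoughPath.HasIntegral {E : Type*} [NormedAddCommGroup E] [NormedSpace ℝ E]
    (X : RoughPath α T d)
    (Y : Set.Icc (0 : ℝ) T → List (Fin d) → (EuclideanSpace ℝ (Fin d) →L[ℝ] E))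
    (L : E) : Prop :=
  ∀ ε > 0, ∃ δ > 0, ∀ (n : ℕ) (τ : ℕ → Set.Icc (0 : ℝ) T), Monotone τ →
    (τ 0 : ℝ) = 0 → (τ n : ℝ) = T → (∀ i < n, (τ (i + 1) : ℝ) - τ i < δ) →
      ‖(∑ i ∈ Finset.range n, X.germ Y (τ i) (τ (i + 1))) - L‖ < ε

open Classical in
/-- The value of the rough integral `∫_0^T Y_s[dX_s]` (zero if it does not exist). -/
def RoughPath.integral {E : Type*} [NormedAddCommGroup E] [NormedSpace ℝ E]
    (X : RoughPath α T d)
    (Y : Set.Icc (0 : ℝ) T → List (Fin d) → (EuclideanSpace ℝ (Fin d) →L[ℝ] E)) : E :=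
  if h : ∃ L, X.HasIntegral Y L then h.choose else 0

end Controlled

/-- Operator-valued kernels on a set `Z`, with values in the bounded operators of a real Hilbert
space `V`. -/
structure OperatorKernel (Z V : Type*) [NormedAddCommGroup V] [InnerProductSpace ℝ V]
    [CompleteSpace V] where
  ker : Z → Z → V →L[ℝ] V
  symm : ∀ x z, ker x z = ContinuousLinearMap.adjoint (ker z x)
  posSemidef : ∀ (N : ℕ) (z : Fin N → Z) (y : Fin N → V),
    (Matrix.of fun i j => ⟪ker (z i) (z j) (y i), y j⟫_ℝ).PosSemidef

namespace OperatorKernel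

section RKHS

variable {Z V : Type*} [NormedAddCommGroup V] [InnerProductSpace ℝ V] [CompleteSpace V]

/-- The kernel as an operator matrix. Mathlib's reproducing kernel functions are the columns of the
matrix, the functions `K(z, ·)v` are its rows, hence the exchange of the arguments. -/
def matrix (K : OperatorKernel Z V) : Matrix Z Z (V →L[ℝ] V) := Matrix.of fun w z => K.ker z w

theorem matrix_posSemidef (K : OperatorKernel Z V) : K.matrix.PosSemidef := by
  have h := (RKHS.posSemidef_tfae (K := K.matrix)).out 0 2
  refine h.mpr ⟨?_, fun v => ?_⟩
  · ext1 i j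
    exact (K.symm j i).symm
  · let e := v.support.equivFin.symm
    have h1 := (K.posSemidef v.support.card (fun i => e i) (fun i => v (e i))).dotProduct_mulVec_nonneg
      (fun _ => 1)
    simp only [dotProduct, Matrix.mulVec, Matrix.of_apply, Pi.star_apply, star_trivial, one_mul,
      mul_one] at h1
    simp only [Finsupp.sum, RCLike.re_to_real, matrix, Matrix.of_apply]
    rw [← Finset.sum_coe_sort v.support, ← e.sum_comp]
    refine h1.trans_eq (Finset.sum_congr rfl fun i _ => ?_)
    rw [← Finset.sum_coe_sort v.support, ← e.sum_comp]

instance (K : OperatorKernel Z V) : Fact K.matrix.PosSemidef := ⟨K.matrix_posSemidef⟩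

/-- The reproducing kernel Hilbert space of `K`, a Hilbert space of functions `Z → V`. -/
abbrev HilbertSpace (K : OperatorKernel Z V) : Type _ := RKHS.OfKernel K.matrix

/-- `K(z, ·)`, as a bounded operator `v ↦ K(z, ·)v` from `V` to the RKHS of `K`. -/
def row (K : OperatorKernel Z V) (z : Z) : V →L[ℝ] K.HilbertSpace := RKHS.kerFun K.HilbertSpace z

/-- The evaluation `f ↦ f(z)` on the RKHS of `K`. -/
def eval (K : OperatorKernel Z V) (z : Z) : K.HilbertSpace →L[ℝ] V :=
  (ContinuousLinearMap.proj z).comp (RKHS.coeCLM ℝ)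

theorem eval_apply (K : OperatorKernel Z V) (z : Z) (f : K.HilbertSpace) : K.eval z f = f z := rfl

theorem row_apply (K : OperatorKernel Z V) (z w : Z) (v : V) : K.row z v w = K.ker z w v := by
  rw [row, RKHS.kerFun_apply, RKHS.OfKernel.kernel_ofKernel]
  rfl

theorem inner_row (K : OperatorKernel Z V) (f : K.HilbertSpace) (z : Z) (v : V) :
    ⟪f, K.row z v⟫_ℝ = ⟪f z, v⟫_ℝ := RKHS.inner_kerFun z v f

end RKHS

section Rough

variable {α T : ℝ} {d : ℕ}

/-- `KX` is a controlled lift along `X` of the `ℒ(ℝ^d; H_K)`-valued path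
`t ↦ K(X|_{[0,t]}, ·)`. -/
def IsLift (K : OperatorKernel (History α T d) (EuclideanSpace ℝ (Fin d))) (X : RoughPath α T d)
    (KX : Set.Icc (0 : ℝ) T → List (Fin d) → (EuclideanSpace ℝ (Fin d) →L[ℝ] K.HilbertSpace)) :
    Prop :=
  X.IsControlledLift (fun t => K.row (X.history t)) KX

/-- The feature `Φ_X = ∫_0^T K(X|_{[0,t]}, ·) dX_t` in the RKHS of `K`. -/
def feature (K : OperatorKernel (History α T d) (EuclideanSpace ℝ (Fin d))) (X : RoughPath α T d)
    (KX : Set.Icc (0 : ℝ) T → List (Fin d) → (EuclideanSpace ℝ (Fin d) →L[ℝ] K.HilbertSpace)) :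
    K.HilbertSpace :=
  X.integral KX

/-- The real-valued kernel `𝒦_Φ(X, Y) = ⟨Φ_X, Φ_Y⟩`. -/
def featureKernel (K : OperatorKernel (History α T d) (EuclideanSpace ℝ (Fin d)))
    (X : RoughPath α T d)
    (KX : Set.Icc (0 : ℝ) T → List (Fin d) → (EuclideanSpace ℝ (Fin d) →L[ℝ] K.HilbertSpace))
    (Y : RoughPath α T d)
    (KY : Set.Icc (0 : ℝ) T → List (Fin d) → (EuclideanSpace ℝ (Fin d) →L[ℝ] K.HilbertSpace)) :
    ℝ :=
  ⟪K.feature X KX, K.feature Y KY⟫_ℝ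

/-- `c` is the iterated rough integral
`∫_{s=0}^T ⟨∫_{t=0}^T K(Y|_{[0,t]}, X|_{[0,s]}) dY_t, dX_s⟩`.
A rough integral is that of a controlled lift of its integrand, and both integrands here inherit
theirs from the given lifts `KX` and `KY` of `K`:
* for fixed `s`, the path `t ↦ K(Y|_{[0,t]}, X|_{[0,s]})` is lifted along `Y` by composing `KY` with
  the evaluation at `X|_{[0,s]}`; its rough integral is `g s`;
* the path `s ↦ ⟨g s, ·⟩` is lifted along `X` by `G`, whose component at a word `I` and a vector `z`
  is the rough integral `∫_0^T ⟨f(Y|_{[0,t]}), dY_t⟩` of the function `f = KX_s[e_I] z`; here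
  `t ↦ ⟨f(Y|_{[0,t]}), ·⟩` is lifted along `Y` by `⟨f, KY_t[e_J](·)⟩`. -/
def HasIteratedIntegral (K : OperatorKernel (History α T d) (EuclideanSpace ℝ (Fin d)))
    (Y : RoughPath α T d)
    (KY : Set.Icc (0 : ℝ) T → List (Fin d) → (EuclideanSpace ℝ (Fin d) →L[ℝ] K.HilbertSpace))
    (X : RoughPath α T d)
    (KX : Set.Icc (0 : ℝ) T → List (Fin d) → (EuclideanSpace ℝ (Fin d) →L[ℝ] K.HilbertSpace))
    (c : ℝ) : Prop :=
  ∃ (g : Set.Icc (0 : ℝ) T → EuclideanSpace ℝ (Fin d))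
    (G : Set.Icc (0 : ℝ) T → List (Fin d) → (EuclideanSpace ℝ (Fin d) →L[ℝ] ℝ)),
    (∀ s, Y.IsControlledLift (fun t => K.ker (Y.history t) (X.history s))
        (fun t J => (K.eval (X.history s)).comp (KY t J)) ∧
      Y.HasIntegral (fun t J => (K.eval (X.history s)).comp (KY t J)) (g s)) ∧
    (∀ s I, I.length < roughLevel α → ∀ z,
      Y.IsControlledLift (fun t => innerSL ℝ ((KX s I z : K.HilbertSpace) (Y.history t)))
        (fun t J => (innerSL ℝ (KX s I z)).comp (KY t J)) ∧
      Y.HasIntegral (fun t J => (innerSL ℝ (KX s I z)).comp (KY t J)) (G s I z)) ∧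
    X.IsControlledLift (fun s => innerSL ℝ (g s)) G ∧
    X.HasIntegral G c

end Rough

end OperatorKernel

end

/-! Rough integration commutes with bounded linear maps, and each integral in the double-integral
formulas is the image of a feature under such a map. Evaluating `ΦY` at the history of `X` up to `s`
gives the inner integral; applying `⟪ΦY, ·⟫` to the integral defining `ΦX` gives the outer one, with
value `⟪ΦY, ΦX⟫`. The reproducing property identifies the integrands, so Fubini needs no exchange of
limits (`IsLift.hasIteratedIntegral`).

The analytic content is the existence of the features. By Chen's relation (`germ_sub_germ_sub_germ`)
the additivity defect of a compensated increment pairs `X` at level `m + 1` with a controlled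
remainder at level `m`. Every such product has order `(⌊1/α⌋ + 1) α > 1`, so the sewing lemma
(`exists_sewing`) applies in the RKHS. -/

/-! ### The sewing lemma on arbitrary partitions. -/

section Sewing

open Finset

variable {E : Type*} [NormedAddCommGroup E]

/-- A monotone sequence crosses the midpoint of its range in one step. -/
theorem exists_step_across_midpoint {n : ℕ} (hn : 0 < n) (τ : ℕ → ℝ) (hτ : Monotone τ) :
    ∃ k < n, τ k - τ 0 ≤ (τ n - τ 0) / 2 ∧ τ n - τ (k + 1) ≤ (τ n - τ 0) / 2 := by
  by_contra! h
  have key : ∀ k, k < n → τ k - τ 0 ≤ (τ n - τ 0) / 2 := by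
    intro k
    induction k with
    | zero =>
      intro _
      have := hτ (Nat.zero_le n)
      linarith
    | succ k ih =>
      intro hk
      have := h k (by omega) (ih (by omega))
      linarith
  -- By `key` even the last step starts in the left half; its end is `τ n`, at distance zero from `τ
  -- n`.
  have h1 := h (n - 1) (by omega) (key _ (by omega))
  rw [Nat.sub_add_cancel hn] at h1
  have := hτ (Nat.zero_le n)
  linarith

/-- An almost additive function vanishes on the diagonal. -/
theorem almost_additive_diag {T θ C : ℝ} (hθ : 0 < θ)
    (A : Set.Icc (0 : ℝ) T → Set.Icc (0 : ℝ) T → E)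
    (hA : ∀ s u t, s ≤ u → u ≤ t → ‖A s t - A s u - A u t‖ ≤ C * ((t : ℝ) - s) ^ θ)
    (s : Set.Icc (0 : ℝ) T) : A s s = 0 := by
  have h := hA s s s le_rfl le_rfl
  rw [sub_self (A s s), sub_self (s : ℝ), Real.zero_rpow hθ.ne', mul_zero, zero_sub,
    norm_neg] at h
  exact norm_le_zero_iff.mp h

/-- The maximal inequality behind the sewing lemma. -/
theorem exists_sewing_maximal {T θ C : ℝ} (hθ : 1 < θ) (hC : 0 ≤ C)
    (A : Set.Icc (0 : ℝ) T → Set.Icc (0 : ℝ) T → E)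
    (hA : ∀ s u t, s ≤ u → u ≤ t → ‖A s t - A s u - A u t‖ ≤ C * ((t : ℝ) - s) ^ θ) :
    ∃ M : ℝ, 0 ≤ M ∧ ∀ (n : ℕ) (τ : ℕ → Set.Icc (0 : ℝ) T), Monotone τ →
      ‖(∑ i ∈ range n, A (τ i) (τ (i + 1))) - A (τ 0) (τ n)‖
        ≤ M * ((τ n : ℝ) - τ 0) ^ θ := by
  have hlt : (2 : ℝ) * (1 / 2) ^ θ < 1 := by
    have h := Real.rpow_lt_rpow_of_exponent_gt (x := 1 / 2) (by norm_num) (by norm_num) hθ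
    rw [Real.rpow_one] at h
    linarith
  set q : ℝ := (1 / 2) ^ θ with hq
  have hdiag := almost_additive_diag (by linarith) A hA
  refine ⟨2 * C / (1 - 2 * q), div_nonneg (by linarith) (by linarith), fun n => ?_⟩
  set M := 2 * C / (1 - 2 * q) with hM
  have hM0 : 0 ≤ M := div_nonneg (by linarith) (by linarith)
  -- `M` is the fixed point of the recursion below: the two outer blocks cost `M * q` each, the two
  -- splittings `C` each. It is nonnegative because `2 * q < 1`, that is, `θ > 1`.
  have hMq : M = 2 * C + 2 * (M * q) := by
    have : M * (1 - 2 * q) = 2 * C := div_mul_cancel₀ _ (by linarith)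
    linarith
  induction n using Nat.strong_induction_on with
  | _ n ih =>
    intro τ hτ
    rcases Nat.eq_zero_or_pos n with rfl | hn
    · simp [hdiag, Real.zero_rpow (by linarith : θ ≠ 0)]
    -- The blocks before and after step `k` have at most half the length. The step itself may be
    -- long, but it appears unsubdivided in the sum and adds no error beyond the two splittings.
    obtain ⟨k, hk, h1, h2⟩ := exists_step_across_midpoint hn (fun i => (τ i : ℝ))
      (fun i j h => hτ h)
    set l : ℝ := (τ n : ℝ) - τ 0 with hl
    have hmono : ∀ i j, i ≤ j → (τ i : ℝ) ≤ τ j := fun i j h => hτ h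
    have hhalf : ∀ x : ℝ, 0 ≤ x → x ≤ l / 2 → M * x ^ θ ≤ M * q * l ^ θ := by
      intro x hx0 hx
      rw [mul_assoc, hq, ← Real.mul_rpow (by norm_num) (by linarith)]
      gcongr
      linarith
    have e1 := (ih k hk τ hτ).trans (hhalf _ (sub_nonneg.2 (hmono _ _ (Nat.zero_le k))) h1)
    have e2 := ih (n - (k + 1)) (by omega) (fun i => τ (k + 1 + i))
      (fun i j h => hτ (by omega))
    have hkn : k + 1 + (n - (k + 1)) = n := by omega
    simp only [hkn, add_zero] at e2
    replace e2 := e2.trans (hhalf _ (sub_nonneg.2 (hmono _ _ hk)) h2)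
    have e3 := hA (τ 0) (τ k) (τ n) (hτ (Nat.zero_le k)) (hτ hk.le)
    have e4 := (hA (τ k) (τ (k + 1)) (τ n) (hτ (Nat.le_succ k)) (hτ hk)).trans
      (mul_le_mul_of_nonneg_left (Real.rpow_le_rpow (sub_nonneg.2 (hmono _ _ hk.le))
        (sub_le_sub_left (hmono 0 k (Nat.zero_le k)) _) (by linarith)) hC)
    have hsum : ∑ i ∈ range n, A (τ i) (τ (i + 1))
        = ∑ i ∈ range k, A (τ i) (τ (i + 1)) + A (τ k) (τ (k + 1))
          + ∑ i ∈ range (n - (k + 1)), A (τ (k + 1 + i)) (τ (k + 1 + (i + 1))) := by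
      rw [← sum_range_succ]
      conv_lhs => rw [← hkn, sum_range_add]
      rfl
    rw [hsum]
    set S1 := ∑ i ∈ range k, A (τ i) (τ (i + 1))
    set S2 := ∑ i ∈ range (n - (k + 1)), A (τ (k + 1 + i)) (τ (k + 1 + (i + 1)))
    have hdec : S1 + A (τ k) (τ (k + 1)) + S2 - A (τ 0) (τ n)
        = (S1 - A (τ 0) (τ k)) + (S2 - A (τ (k + 1)) (τ n))
          - (A (τ 0) (τ n) - A (τ 0) (τ k) - A (τ k) (τ n))
          - (A (τ k) (τ n) - A (τ k) (τ (k + 1)) - A (τ (k + 1)) (τ n)) := by abel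
    rw [hdec]
    calc _ ≤ ‖S1 - A (τ 0) (τ k)‖ + ‖S2 - A (τ (k + 1)) (τ n)‖
          + ‖A (τ 0) (τ n) - A (τ 0) (τ k) - A (τ k) (τ n)‖
          + ‖A (τ k) (τ n) - A (τ k) (τ (k + 1)) - A (τ (k + 1)) (τ n)‖ :=
        (norm_sub_le _ _).trans (add_le_add_left ((norm_sub_le _ _).trans
          (add_le_add_left (norm_add_le _ _) _)) _)
      _ ≤ M * q * l ^ θ + M * q * l ^ θ + C * l ^ θ + C * l ^ θ := by gcongr
      _ = (2 * C + 2 * (M * q)) * l ^ θ := by ring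
      _ = M * l ^ θ := by rw [← hMq]

/-- Clamping `[c, e]` to `[a, b]` and clamping `[a, b]` to `[c, e]` give the same interval, or two
degenerate ones. -/
theorem clamp_increment_comm {T : ℝ} {A : Set.Icc (0 : ℝ) T → Set.Icc (0 : ℝ) T → E}
    (hdiag : ∀ s, A s s = 0) {a b c e : Set.Icc (0 : ℝ) T} (hab : a ≤ b) (hce : c ≤ e) :
    A (max a (min c b)) (max a (min e b)) = A (max c (min a e)) (max c (min b e)) := by
  rcases le_total b c with h | h
  · rw [min_eq_right h, min_eq_right (h.trans hce), min_eq_left (hab.trans (h.trans hce)),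
      min_eq_left (h.trans hce), max_eq_left (hab.trans h), max_eq_left h, hdiag, hdiag]
  rcases le_total e a with h' | h'
  · rw [min_eq_left (hce.trans (h'.trans hab)), min_eq_left (h'.trans hab), min_eq_right h',
      min_eq_right (h'.trans hab), max_eq_left (hce.trans h'), max_eq_left h', hdiag, hdiag]
  rw [min_eq_left h, min_eq_left h', max_comm a c, min_comm e b, max_eq_right (le_min hab h'),
    max_eq_right (le_min h hce)]

/-- Two Riemann sums of an almost additive function over the same interval are close. -/
theorem norm_sum_sub_sum_le {T θ M : ℝ}
    (A : Set.Icc (0 : ℝ) T → Set.Icc (0 : ℝ) T → E) (hdiag : ∀ s, A s s = 0)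
    (hA : ∀ (n : ℕ) (τ : ℕ → Set.Icc (0 : ℝ) T), Monotone τ →
      ‖(∑ i ∈ range n, A (τ i) (τ (i + 1))) - A (τ 0) (τ n)‖ ≤ M * ((τ n : ℝ) - τ 0) ^ θ)
    {n m : ℕ} {τ σ : ℕ → Set.Icc (0 : ℝ) T} (hτ : Monotone τ) (hσ : Monotone σ)
    (h0 : τ 0 = σ 0) (h1 : τ n = σ m) :
    ‖(∑ i ∈ range n, A (τ i) (τ (i + 1))) - ∑ j ∈ range m, A (σ j) (σ (j + 1))‖
      ≤ M * ∑ i ∈ range n, ((τ (i + 1) : ℝ) - τ i) ^ θ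
        + M * ∑ j ∈ range m, ((σ (j + 1) : ℝ) - σ j) ^ θ := by
  -- Clamping `σ` to each interval of `τ` subdivides that interval, so the maximal inequality
  -- applies there. The double sum plays the role of the common refinement, without sorting the
  -- points.
  have key : ∀ {n m : ℕ} {τ σ : ℕ → Set.Icc (0 : ℝ) T}, Monotone τ → Monotone σ →
      τ 0 = σ 0 → τ n = σ m →
      ‖(∑ i ∈ range n, ∑ j ∈ range m, A (max (τ i) (min (σ j) (τ (i + 1))))
        (max (τ i) (min (σ (j + 1)) (τ (i + 1))))) - ∑ i ∈ range n, A (τ i) (τ (i + 1))‖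
        ≤ M * ∑ i ∈ range n, ((τ (i + 1) : ℝ) - τ i) ^ θ := by
    intro n m τ σ hτ hσ h0 h1
    rw [← sum_sub_distrib, mul_sum]
    refine norm_sum_le_of_le _ fun i hi => ?_
    have hi' : i + 1 ≤ n := mem_range.1 hi
    have h := hA m (fun j => max (τ i) (min (σ j) (τ (i + 1)))) (fun j j' hj =>
      max_le_max le_rfl (min_le_min (hσ hj) le_rfl))
    have e0 : max (τ i) (min (σ 0) (τ (i + 1))) = τ i := by
      rw [← h0, min_eq_left (hτ (Nat.zero_le _)), max_eq_left (hτ (Nat.zero_le _))]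
    have e1 : max (τ i) (min (σ m) (τ (i + 1))) = τ (i + 1) := by
      rw [← h1, min_eq_right (hτ hi'), max_eq_right (hτ (Nat.le_succ _))]
    simpa only [e0, e1] using h
  have hτσ := key hτ hσ h0 h1
  have hστ := key hσ hτ h0.symm h1.symm
  -- Refining `σ` by `τ` yields the same double sum as refining `τ` by `σ`, so the two estimates
  -- share a middle term.
  rw [sum_comm, sum_congr rfl fun i _ => sum_congr rfl fun j _ =>
    clamp_increment_comm hdiag (hσ (Nat.le_succ j)) (hτ (Nat.le_succ i))] at hστ
  rw [← norm_neg, neg_sub] at hτσ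
  exact (norm_sub_le_norm_sub_add_norm_sub _ _ _).trans (add_le_add hτσ hστ)

/-- Splitting off the power `θ - 1` of each increment leaves a telescoping sum. Since `θ > 1`, the
bound vanishes with the mesh. -/
theorem sum_rpow_increment_le {T θ δ : ℝ} (hθ : 1 < θ) (hδ : 0 ≤ δ) {n : ℕ}
    {τ : ℕ → Set.Icc (0 : ℝ) T} (hτ : Monotone τ)
    (hmesh : ∀ i < n, (τ (i + 1) : ℝ) - τ i ≤ δ) :
    ∑ i ∈ range n, ((τ (i + 1) : ℝ) - τ i) ^ θ ≤ δ ^ (θ - 1) * T := by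
  have h : ∀ i ∈ range n, ((τ (i + 1) : ℝ) - τ i) ^ θ
      ≤ δ ^ (θ - 1) * ((τ (i + 1) : ℝ) - τ i) := by
    intro i hi
    have h0 : 0 ≤ (τ (i + 1) : ℝ) - τ i := sub_nonneg.2 (hτ (Nat.le_succ i))
    calc ((τ (i + 1) : ℝ) - τ i) ^ θ
        = ((τ (i + 1) : ℝ) - τ i) ^ (θ - 1) * ((τ (i + 1) : ℝ) - τ i) := by
          conv_lhs => rw [← sub_add_cancel θ 1, Real.rpow_add_one' h0 (by linarith)]
      _ ≤ _ := mul_le_mul_of_nonneg_right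
          (Real.rpow_le_rpow h0 (hmesh i (mem_range.1 hi)) (by linarith)) h0
  refine (sum_le_sum h).trans ?_
  rw [← mul_sum, sum_range_sub (fun i => (τ i : ℝ))]
  refine mul_le_mul_of_nonneg_left ?_ (Real.rpow_nonneg hδ _)
  linarith [(τ n).2.2, (τ 0).2.1]

/-- The sewing lemma: Riemann sums of an almost additive function converge. -/
theorem exists_sewing [CompleteSpace E] {T θ C : ℝ} (hT : 0 ≤ T) (hθ : 1 < θ) (hC : 0 ≤ C)
    (A : Set.Icc (0 : ℝ) T → Set.Icc (0 : ℝ) T → E)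
    (hA : ∀ s u t, s ≤ u → u ≤ t → ‖A s t - A s u - A u t‖ ≤ C * ((t : ℝ) - s) ^ θ) :
    ∃ L : E, ∀ ε > 0, ∃ δ > 0, ∀ (n : ℕ) (τ : ℕ → Set.Icc (0 : ℝ) T), Monotone τ →
      (τ 0 : ℝ) = 0 → (τ n : ℝ) = T → (∀ i < n, (τ (i + 1) : ℝ) - τ i < δ) →
        ‖(∑ i ∈ range n, A (τ i) (τ (i + 1))) - L‖ < ε := by
  obtain ⟨M, hM, hmax⟩ := exists_sewing_maximal hθ hC A hA
  have hdiag := almost_additive_diag (by linarith) A hA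
  have hsmall : ∀ ε > 0, ∃ δ > 0, M * (δ ^ (θ - 1) * T) < ε := by
    intro ε hε
    have hcont : Filter.Tendsto (fun δ : ℝ => M * (δ ^ (θ - 1) * T)) (nhdsWithin 0 (Set.Ioi 0))
        (nhds (M * ((0 : ℝ) ^ (θ - 1) * T))) :=
      (((Real.continuousAt_rpow_const 0 (θ - 1) (Or.inr (by linarith))).mul_const T).const_mul
        M).mono_left nhdsWithin_le_nhds
    rw [Real.zero_rpow (by linarith), zero_mul, mul_zero] at hcont
    obtain ⟨δ, h1, h2⟩ := ((hcont.eventually (gt_mem_nhds hε)).and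
      self_mem_nhdsWithin).exists
    exact ⟨δ, h2, h1⟩
  have hcmp : ∀ ε > 0, ∃ δ > 0, ∀ (n m : ℕ) (τ σ : ℕ → Set.Icc (0 : ℝ) T), Monotone τ →
      Monotone σ → (τ 0 : ℝ) = 0 → (σ 0 : ℝ) = 0 → (τ n : ℝ) = T → (σ m : ℝ) = T →
      (∀ i < n, (τ (i + 1) : ℝ) - τ i < δ) → (∀ i < m, (σ (i + 1) : ℝ) - σ i < δ) →
      ‖(∑ i ∈ range n, A (τ i) (τ (i + 1))) - ∑ j ∈ range m, A (σ j) (σ (j + 1))‖ < ε := by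
    intro ε hε
    obtain ⟨δ, hδ, hδε⟩ := hsmall (ε / 2) (by linarith)
    refine ⟨δ, hδ, fun n m τ σ hτ hσ hτ0 hσ0 hτ1 hσ1 hτδ hσδ => ?_⟩
    refine (norm_sum_sub_sum_le A hdiag hmax hτ hσ
      (Subtype.ext (hτ0.trans hσ0.symm)) (Subtype.ext (hτ1.trans hσ1.symm))).trans_lt ?_
    have e1 := mul_le_mul_of_nonneg_left
      (sum_rpow_increment_le hθ hδ.le hτ fun i hi => (hτδ i hi).le) hM
    have e2 := mul_le_mul_of_nonneg_left
      (sum_rpow_increment_le hθ hδ.le hσ fun i hi => (hσδ i hi).le) hM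
    linarith
  -- Uniform partition into `n + 1` steps; the projection keeps it in `[0, T]` and monotone past the
  -- last index. The limit along these partitions is `L`, and `hcmp` transfers it to all fine
  -- partitions.
  let u : ℕ → ℕ → Set.Icc (0 : ℝ) T := fun n i =>
    Set.projIcc 0 T hT (T * (i / (n + 1)))
  have hu : ∀ n, Monotone (u n) := fun n i j hij =>
    Set.monotone_projIcc hT (by gcongr)
  have hu0 : ∀ n, (u n 0 : ℝ) = 0 := fun n => by simp [u, Set.projIcc, hT]
  have hu1 : ∀ n, (u n (n + 1) : ℝ) = T := fun n => by
    have : T * (((n + 1 : ℕ) : ℝ) / (n + 1)) = T := by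
      push_cast
      rw [div_self (by positivity), mul_one]
    simp only [u, this, Set.projIcc_right]
  have hval : ∀ n i, i ≤ n + 1 → (u n i : ℝ) = T * (i / (n + 1)) := by
    intro n i hi
    have h1 : (i : ℝ) / (n + 1) ≤ 1 := by
      rw [div_le_one (by positivity)]
      exact_mod_cast hi
    simp only [u]
    rw [Set.projIcc_of_mem hT ⟨by positivity, mul_le_of_le_one_right hT h1⟩]
  have humesh : ∀ δ > 0, ∃ n₀, ∀ n ≥ n₀, ∀ i < n + 1, (u n (i + 1) : ℝ) - u n i < δ := by
    intro δ hδ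
    obtain ⟨n₀, hn₀⟩ := exists_nat_gt (T / δ)
    refine ⟨n₀, fun n hn i hi => ?_⟩
    rw [hval n _ hi, hval n _ hi.le, ← mul_sub, ← sub_div]
    push_cast
    rw [add_sub_cancel_left, mul_one_div, div_lt_iff₀ (by positivity)]
    have : (n₀ : ℝ) ≤ n := by exact_mod_cast hn
    rw [div_lt_iff₀ hδ] at hn₀
    nlinarith
  have hcauchy : CauchySeq fun n => ∑ i ∈ range (n + 1), A (u n i) (u n (i + 1)) := by
    refine Metric.cauchySeq_iff.2 fun ε hε => ?_
    obtain ⟨δ, hδ, h⟩ := hcmp ε hε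
    obtain ⟨n₀, hn₀⟩ := humesh δ hδ
    refine ⟨n₀, fun n hn m hm => ?_⟩
    rw [dist_eq_norm]
    exact h _ _ _ _ (hu n) (hu m) (hu0 n) (hu0 m) (hu1 n) (hu1 m) (hn₀ n hn) (hn₀ m hm)
  obtain ⟨L, hL⟩ := cauchySeq_tendsto_of_complete hcauchy
  refine ⟨L, fun ε hε => ?_⟩
  obtain ⟨δ, hδ, h⟩ := hcmp (ε / 2) (by linarith)
  obtain ⟨n₀, hn₀⟩ := humesh δ hδ
  refine ⟨δ, hδ, fun n τ hτ hτ0 hτ1 hτδ => ?_⟩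
  obtain ⟨m, hm, hmL⟩ := ((Filter.eventually_ge_atTop n₀).and
    (hL.eventually (Metric.ball_mem_nhds L (half_pos hε)))).exists
  have e1 := h _ _ _ _ hτ (hu m) hτ0 (hu0 m) hτ1 (hu1 m) hτδ (hn₀ m hm)
  rw [dist_eq_norm] at hmL
  exact (norm_sub_le_norm_sub_add_norm_sub _ _ _).trans_lt (by linarith)

end Sewing

/-! ### Compensated increments and existence of the rough integral. -/

namespace RoughPath

open Finset

variable {α T : ℝ} {d : ℕ}

/-- Summing over words and their deconcatenations is summing over pairs of words. -/
theorem sum_words_take_drop {M : Type*} [AddCommMonoid M] (N : ℕ)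
    (F : List (Fin d) → List (Fin d) → M) :
    ∑ m ∈ range N, ∑ I : Fin m → Fin d, ∑ i ∈ range (m + 1),
        F ((List.ofFn I).take i) ((List.ofFn I).drop i)
      = ∑ q ∈ range N, ∑ Q : Fin q → Fin d, ∑ p ∈ range (N - q), ∑ P : Fin p → Fin d,
        F (List.ofFn P) (List.ofFn Q) := by
  -- For a fixed cut position, a word of length `p + q` is the same as a pair of words of lengths
  -- `p` and `q`.
  have hsplit : ∀ p q : ℕ, ∑ I : Fin (p + q) → Fin d,
      F ((List.ofFn I).take p) ((List.ofFn I).drop p)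
      = ∑ Q : Fin q → Fin d, ∑ P : Fin p → Fin d, F (List.ofFn P) (List.ofFn Q) := by
    intro p q
    rw [← (Fin.appendEquiv p q).sum_comp, Fintype.sum_prod_type_right]
    refine sum_congr rfl fun Q _ => sum_congr rfl fun P _ => ?_
    have h : List.ofFn (Fin.append P Q) = List.ofFn P ++ List.ofFn Q := List.ofFn_fin_append P Q
    simp only [Fin.appendEquiv, Equiv.coe_fn_mk, h]
    rw [List.take_left' (List.length_ofFn), List.drop_left' (List.length_ofFn)]
  calc _ = ∑ m ∈ range N, ∑ i ∈ range (m + 1), ∑ Q : Fin (m - i) → Fin d, ∑ P : Fin i → Fin d,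
        F (List.ofFn P) (List.ofFn Q) := by
        refine sum_congr rfl fun m _ => ?_
        rw [sum_comm]
        refine sum_congr rfl fun i hi => ?_
        obtain ⟨q, rfl⟩ := Nat.exists_eq_add_of_le (Nat.lt_succ_iff.1 (mem_range.1 hi))
        rw [hsplit, Nat.add_sub_cancel_left]
    _ = ∑ p ∈ range N, ∑ q ∈ range (N - p), ∑ Q : Fin q → Fin d, ∑ P : Fin p → Fin d,
        F (List.ofFn P) (List.ofFn Q) :=
        sum_range_diag_flip N fun i q => ∑ Q : Fin q → Fin d, ∑ P : Fin i → Fin d,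
          F (List.ofFn P) (List.ofFn Q)
    _ = ∑ q ∈ range N, ∑ p ∈ range (N - q), ∑ Q : Fin q → Fin d, ∑ P : Fin p → Fin d,
        F (List.ofFn P) (List.ofFn Q) := by
        refine sum_comm' fun p q => ?_
        simp only [mem_range]
        omega
    _ = _ := sum_congr rfl fun q _ => sum_comm

variable {E E' : Type*} [NormedAddCommGroup E] [NormedSpace ℝ E] [NormedAddCommGroup E']
  [NormedSpace ℝ E']

/-- Chen's relation for compensated increments. -/
theorem germ_sub_germ_sub_germ (X : RoughPath α T d)
    (Y : Set.Icc (0 : ℝ) T → List (Fin d) → (EuclideanSpace ℝ (Fin d) →L[ℝ] E))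
    {s u t : Set.Icc (0 : ℝ) T} (hsu : s ≤ u) (hut : u ≤ t) :
    X.germ Y s t - X.germ Y s u - X.germ Y u t
      = -∑ m ∈ range (roughLevel α), ∑ I : Fin m → Fin d, ∑ k : Fin d,
        X.coord u t (List.ofFn I ++ [k]) •
          (Y u (List.ofFn I) - X.transport Y s u (List.ofFn I)) (EuclideanSpace.single k 1) := by
  -- Chen's relation for the word `Ik`: the cut after the final letter `k` gives the increment over
  -- `[s, u]`; all other cuts leave `k` in the factor over `[u, t]`.
  have hst : X.germ Y s t = X.germ Y s u
      + ∑ m ∈ range (roughLevel α), ∑ I : Fin m → Fin d, ∑ i ∈ range (m + 1), ∑ k : Fin d,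
        (X.coord s u ((List.ofFn I).take i) * X.coord u t ((List.ofFn I).drop i ++ [k])) •
          Y s ((List.ofFn I).take i ++ (List.ofFn I).drop i) (EuclideanSpace.single k 1) := by
    simp only [germ, ← sum_add_distrib]
    refine sum_congr rfl fun m hm => sum_congr rfl fun I _ => ?_
    rw [sum_comm, ← sum_add_distrib]
    refine sum_congr rfl fun k _ => ?_
    have hlen : (List.ofFn I ++ [k]).length = m + 1 := by simp
    rw [X.chen s u t s.2.1 hsu hut t.2.2 _ (by rw [hlen]; exact mem_range.1 hm), hlen,
      sum_range_succ, List.take_of_length_le hlen.le, List.drop_of_length_le hlen.le,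
      X.coord_nil u t u.2.1 hut t.2.2, mul_one, add_smul, add_comm, sum_smul]
    congr 1
    refine sum_congr rfl fun i hi => ?_
    have hi' : i ≤ (List.ofFn I).length := by
      rw [List.length_ofFn]
      exact Nat.lt_succ_iff.1 (mem_range.1 hi)
    rw [List.take_append_of_le_length hi', List.drop_append_of_le_length hi',
      List.take_append_drop]
  -- Grouped by the suffix `Q`, the sum over prefixes `P` is exactly `X.transport Y s u Q`.
  rw [hst, sum_words_take_drop (roughLevel α) fun P Q => ∑ k : Fin d,
    (X.coord s u P * X.coord u t (Q ++ [k])) • Y s (P ++ Q) (EuclideanSpace.single k 1),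
    add_sub_cancel_left, germ, ← sum_sub_distrib, ← sum_neg_distrib]
  refine sum_congr rfl fun q hq => ?_
  rw [← sum_sub_distrib, ← sum_neg_distrib]
  refine sum_congr rfl fun Q _ => ?_
  rw [← sum_neg_distrib, sum_congr rfl fun p _ => sum_comm, sum_comm, ← sum_sub_distrib]
  refine sum_congr rfl fun k _ => ?_
  rw [sub_apply, smul_sub, neg_sub, transport, List.length_ofFn,
    _root_.sum_apply, smul_sum]
  congr 1
  refine sum_congr rfl fun p _ => ?_
  rw [_root_.sum_apply, smul_sum]
  refine sum_congr rfl fun P _ => ?_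
  rw [smul_apply, smul_smul, mul_comm]

/-- At level `m` the defect is a factor of order `(m + 1) α` times a remainder of order `(⌊1/α⌋ - m)
α`; the exponents add up to `(⌊1/α⌋ + 1) α`, independently of `m`, and sewing applies. -/
theorem IsControlledLift.exists_hasIntegral [CompleteSpace E] (hα : 0 < α) (hT : 0 ≤ T)
    {X : RoughPath α T d} {y : Set.Icc (0 : ℝ) T → (EuclideanSpace ℝ (Fin d) →L[ℝ] E)}
    {Y : Set.Icc (0 : ℝ) T → List (Fin d) → (EuclideanSpace ℝ (Fin d) →L[ℝ] E)}
    (hY : X.IsControlledLift y Y) : ∃ L, X.HasIntegral Y L := by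
  obtain ⟨C, hC⟩ := X.holder
  obtain ⟨D, hD⟩ := hY.remainder
  have hθ : 1 < ((roughLevel α : ℝ) + 1) * α := by
    rw [← div_lt_iff₀ hα]
    exact Nat.lt_floor_add_one _
  refine exists_sewing (θ := ((roughLevel α : ℝ) + 1) * α)
    (C := ∑ m ∈ range (roughLevel α), ∑ _I : Fin m → Fin d, ∑ _k : Fin d, |C| * |D|) hT hθ
    (by positivity) (X.germ Y) fun s u t hsu hut => ?_
  rw [X.germ_sub_germ_sub_germ Y hsu hut, norm_neg, sum_mul]
  refine norm_sum_le_of_le _ fun m hm => ?_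
  rw [sum_mul]
  refine norm_sum_le_of_le _ fun I _ => ?_
  rw [sum_mul]
  refine norm_sum_le_of_le _ fun k _ => ?_
  have hm' := mem_range.1 hm
  have hmR : (m : ℝ) ≤ roughLevel α := by exact_mod_cast hm'.le
  have hsu' : (s : ℝ) ≤ u := hsu
  have hut' : (u : ℝ) ≤ t := hut
  have h1 := hC u t u.2.1 hut t.2.2 (List.ofFn I ++ [k]) (by simpa using hm')
  have h2 := hD s u hsu (List.ofFn I) (by simpa using hm')
  simp only [List.length_append, List.length_ofFn, List.length_singleton, Nat.cast_add,
    Nat.cast_one] at h1 h2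
  -- Absolute values, since the Hölder constants are not assumed nonnegative. Both factors are
  -- enlarged to powers of `t - s` so that the exponents add.
  have h3 : |X.coord u t (List.ofFn I ++ [k])| ≤ |C| * ((t : ℝ) - s) ^ (((m : ℝ) + 1) * α) :=
    h1.trans (mul_le_mul (le_abs_self C)
      (Real.rpow_le_rpow (by linarith) (by linarith) (by positivity))
      (Real.rpow_nonneg (by linarith) _) (abs_nonneg C))
  have h4 : ‖Y u (List.ofFn I) - X.transport Y s u (List.ofFn I)‖
      ≤ |D| * ((t : ℝ) - s) ^ (((roughLevel α : ℝ) - m) * α) :=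
    h2.trans (mul_le_mul (le_abs_self D)
      (Real.rpow_le_rpow (by linarith) (by linarith) (mul_nonneg (by linarith) hα.le))
      (Real.rpow_nonneg (by linarith) _) (abs_nonneg D))
  have h5 : ‖(Y u (List.ofFn I) - X.transport Y s u (List.ofFn I))
      (EuclideanSpace.single k 1)‖ ≤ |D| * ((t : ℝ) - s) ^ (((roughLevel α : ℝ) - m) * α) := by
    refine (ContinuousLinearMap.le_opNorm _ _).trans ?_
    rw [PiLp.norm_single, norm_one, mul_one]
    exact h4
  rw [norm_smul, Real.norm_eq_abs]
  refine (mul_le_mul h3 h5 (norm_nonneg _)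
    (mul_nonneg (abs_nonneg C) (Real.rpow_nonneg (by linarith) _))).trans_eq ?_
  rw [mul_mul_mul_comm, ← Real.rpow_add_of_nonneg (by linarith) (by positivity)
    (mul_nonneg (by linarith) hα.le)]
  congr 2
  ring

/-- Uniqueness of the limit is not needed: the Fubini argument works for any limits `ΦX` and `ΦY`.
-/
theorem hasIntegral_integral {X : RoughPath α T d}
    {Y : Set.Icc (0 : ℝ) T → List (Fin d) → (EuclideanSpace ℝ (Fin d) →L[ℝ] E)}
    (h : ∃ L, X.HasIntegral Y L) : X.HasIntegral Y (X.integral Y) := by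
  rw [integral, dif_pos h]
  exact h.choose_spec

/-! ### Compatibility with bounded linear maps. -/

theorem germ_clm_comp (X : RoughPath α T d) (A : E →L[ℝ] E')
    (Y : Set.Icc (0 : ℝ) T → List (Fin d) → (EuclideanSpace ℝ (Fin d) →L[ℝ] E))
    (s t : Set.Icc (0 : ℝ) T) :
    X.germ (fun t I => A.comp (Y t I)) s t = A (X.germ Y s t) := by
  simp only [germ, map_sum, map_smul, ContinuousLinearMap.comp_apply]

/-- Rough integration commutes with bounded linear maps. -/
theorem HasIntegral.clm_comp {X : RoughPath α T d}
    {Y : Set.Icc (0 : ℝ) T → List (Fin d) → (EuclideanSpace ℝ (Fin d) →L[ℝ] E)} {L : E}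
    (h : X.HasIntegral Y L) (A : E →L[ℝ] E') :
    X.HasIntegral (fun t I => A.comp (Y t I)) (A L) := by
  intro ε hε
  -- The `+ 1` covers `A = 0`.
  obtain ⟨δ, hδ, hL⟩ := h (ε / (‖A‖ + 1)) (by positivity)
  refine ⟨δ, hδ, fun n τ hτ h0 h1 hm => ?_⟩
  have h2 := hL n τ hτ h0 h1 hm
  rw [lt_div_iff₀ (by positivity)] at h2
  simp only [germ_clm_comp, ← map_sum, ← map_sub]
  refine (A.le_opNorm _).trans_lt (lt_of_le_of_lt ?_ h2)
  rw [mul_comm]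
  gcongr
  linarith

theorem transport_clm (X : RoughPath α T d) (A : E →L[ℝ] E')
    (Y : Set.Icc (0 : ℝ) T → List (Fin d) → E) (s t : Set.Icc (0 : ℝ) T) (I : List (Fin d)) :
    X.transport (fun t I => A (Y t I)) s t I = A (X.transport Y s t I) := by
  simp only [transport, map_sum, map_smul]

/-- Bounded linear maps send controlled lifts to controlled lifts. -/
theorem IsControlledLift.clm_apply {X : RoughPath α T d} {y : Set.Icc (0 : ℝ) T → E}
    {Y : Set.Icc (0 : ℝ) T → List (Fin d) → E} (h : X.IsControlledLift y Y) (A : E →L[ℝ] E') :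
    X.IsControlledLift (fun t => A (y t)) (fun t I => A (Y t I)) := by
  refine ⟨fun t => by rw [h.lifts], ?_, ?_⟩
  · obtain ⟨C, hC⟩ := h.remainder
    refine ⟨‖A‖ * C, fun s t hst I hI => ?_⟩
    rw [transport_clm, ← map_sub, mul_assoc]
    exact (A.le_opNorm _).trans (mul_le_mul_of_nonneg_left (hC s t hst I hI) (norm_nonneg A))
  · obtain ⟨C, hC⟩ := h.holder
    refine ⟨‖A‖ * C, fun s t hst I hI => ?_⟩
    rw [← map_sub, mul_assoc]
    exact (A.le_opNorm _).trans (mul_le_mul_of_nonneg_left (hC s t hst I hI) (norm_nonneg A))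

/-- Postcomposition with `A` is itself a bounded linear map between operator spaces. -/
theorem IsControlledLift.clm_comp {X : RoughPath α T d}
    {y : Set.Icc (0 : ℝ) T → (EuclideanSpace ℝ (Fin d) →L[ℝ] E)}
    {Y : Set.Icc (0 : ℝ) T → List (Fin d) → (EuclideanSpace ℝ (Fin d) →L[ℝ] E)}
    (h : X.IsControlledLift y Y) (A : E →L[ℝ] E') :
    X.IsControlledLift (fun t => A.comp (y t)) (fun t I => A.comp (Y t I)) :=
  h.clm_apply (ContinuousLinearMap.compL ℝ (EuclideanSpace ℝ (Fin d)) E E' A)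

end RoughPath

/-! ### Features and the Fubini formula. -/

namespace OperatorKernel

variable {α T : ℝ} {d : ℕ}

theorem IsLift.hasIntegral_feature (hα : 0 < α) (hT : 0 ≤ T)
    {K : OperatorKernel (History α T d) (EuclideanSpace ℝ (Fin d))} {X : RoughPath α T d}
    {KX : Set.Icc (0 : ℝ) T → List (Fin d) → (EuclideanSpace ℝ (Fin d) →L[ℝ] K.HilbertSpace)}
    (h : K.IsLift X KX) : X.HasIntegral KX (K.feature X KX) :=
  RoughPath.hasIntegral_integral (RoughPath.IsControlledLift.exists_hasIntegral hα hT h)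

/-- Fubini for rough integrals of a kernel. -/
theorem IsLift.hasIteratedIntegral
    {K : OperatorKernel (History α T d) (EuclideanSpace ℝ (Fin d))} {X Y : RoughPath α T d}
    {KX KY : Set.Icc (0 : ℝ) T → List (Fin d) →
      (EuclideanSpace ℝ (Fin d) →L[ℝ] K.HilbertSpace)}
    (hX : K.IsLift X KX) (hY : K.IsLift Y KY) {ΦX ΦY : K.HilbertSpace}
    (hΦX : X.HasIntegral KX ΦX) (hΦY : Y.HasIntegral KY ΦY) :
    K.HasIteratedIntegral Y KY X KX ⟪ΦY, ΦX⟫_ℝ := by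
  -- Both witnesses come from `ΦY`: evaluation gives the inner integral, and pairing with the lift
  -- `KX` gives the lift of the outer integrand.
  refine ⟨fun s => K.eval (X.history s) ΦY, fun s I => (innerSL ℝ ΦY).comp (KX s I),
    fun s => ⟨?_, hΦY.clm_comp _⟩, fun s I _ z => ⟨?_, ?_⟩, ?_, hΦX.clm_comp (innerSL ℝ ΦY)⟩
  · convert RoughPath.IsControlledLift.clm_comp hY (K.eval (X.history s)) using 2 with t
    ext1 v
    rw [ContinuousLinearMap.comp_apply, eval_apply, row_apply]
  · convert RoughPath.IsControlledLift.clm_comp hY (innerSL ℝ (KX s I z)) using 2 with t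
    ext1 v
    rw [ContinuousLinearMap.comp_apply, innerSL_apply_apply, innerSL_apply_apply, inner_row]
  · have h := hΦY.clm_comp (innerSL ℝ (KX s I z))
    rwa [innerSL_apply_apply, real_inner_comm] at h
  -- The reproducing property for `ΦY` itself: pairing it with `K(X|_{[0,s]}, ·)v` evaluates it at
  -- that history, so `G` lifts `⟨g s, ·⟩`.
  · convert RoughPath.IsControlledLift.clm_comp hX (innerSL ℝ ΦY) using 2 with s
    ext1 v
    rw [ContinuousLinearMap.comp_apply, innerSL_apply_apply, innerSL_apply_apply, inner_row]
    rfl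

end OperatorKernel

theorem mainTheorem7 {α T : ℝ} (hα₀ : 0 < α) (hα₁ : α < 1) (hT : 0 < T) {d : ℕ}
    (K : OperatorKernel (History α T d) (EuclideanSpace ℝ (Fin d)))
    (X Y : RoughPath α T d)
    (KX KY : Set.Icc (0 : ℝ) T → List (Fin d) →
      (EuclideanSpace ℝ (Fin d) →L[ℝ] K.HilbertSpace))
    (hKX : K.IsLift X KX) (hKY : K.IsLift Y KY) :
    X.HasIntegral KX (K.feature X KX) ∧
    Y.HasIntegral KY (K.feature Y KY) ∧
    K.HasIteratedIntegral Y KY X KX (K.featureKernel X KX Y KY) ∧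
    K.HasIteratedIntegral X KX Y KY (K.featureKernel X KX Y KY) := by
  have hX := hKX.hasIntegral_feature hα₀ hT.le
  have hY := hKY.hasIntegral_feature hα₀ hT.le
  refine ⟨hX, hY, ?_, hKY.hasIteratedIntegral hKX hY hX⟩
  -- The Fubini lemma puts the inner feature first in the inner product, so only this order of
  -- integration needs symmetry.
  rw [OperatorKernel.featureKernel, real_inner_comm]
  exact hKX.hasIteratedIntegral hKY hX hY
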